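/- Let $\mathcal{A}$ be a locally noetherian Grothendieck category, that is, a Grothendieck category with a set of generators consisting of noetherian objects. A nonzero object $H$ of $\mathcal{A}$ is called monoform if for every nonzero subobject $N$ of $H$ no nonzero subobject of $H$ is isomorphic to a subobject of $H/N$; two monoform objects are atom-equivalent if they have a common nonzero subobject up to isomorphism, and an atom is an equivalence class of monoform objects. Let $\alpha$ be an atom, and let $E(\alpha)$ be an injective hull of some $H\in\alpha$ (such a hull exists; the statement holds for every choice of it). Let $\mathcal{S}$ be the spectral category of $\mathcal{A}$: it has the same objects as $\mathcal{A}$, its morphism groups are $$\mathrm{Hom}_{\mathcal{S}}(M,N)=\varinjlim_{M'}\mathrm{Hom}_{\mathcal{A}}(M',N),$$ where $M'$ runs over the essential subobjects of $M$, and the composite of the classes of $f:L'\to M$ and $g:M'\to N$ is the class of $f^{-1}(M')\to M'\xrightarrow{g}N$. Let $P:\mathcal{A}\to\mathcal{S}$ be the canonical functor, and put $k(\alpha)=\mathrm{End}_{\mathcal{S}}(P(E(\alpha)))$. Then $k(\alpha)$ is a skew field, and the following hold. 1. Among the monoform subobjects of $E(\alpha)$ there is a largest one, $H_\alpha$, and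 there is a ring isomorphism $\mathrm{End}_{\mathcal{A}}(H_\alpha)\cong k(\alpha)$. 2. The ring $\mathrm{End}_{\mathcal{A}}(E(\alpha))$ is local; its non-units form a two-sided ideal $J_\alpha$, which is its unique maximal left ideal; and there is a ring isomorphism $\mathrm{End}_{\mathcal{A}}(E(\alpha))/J_\alpha\cong k(\alpha)$. In particular, both isomorphisms are isomorphisms of skew fields. -/

import Mathlib

universe w v u

open CategoryTheory

namespace Atoms

/-- A Grothendieck category is locally noetherian if it has a (`w`-small) set of generators
consisting of noetherian objects. -/
class IsLocallyNoetherian (C : Type u) [Category.{v} C] : Prop where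
  exists_generators : ∃ P : ObjectProperty C,
    ObjectProperty.Small.{w} P ∧ P ≤ isNoetherianObject ∧ P.IsSeparating

/-- A ring is a skew field if it is nonzero and each nonzero element is invertible. -/
def IsSkewField (R : Type*) [Ring R] : Prop :=
  Nontrivial R ∧ ∀ a : R, a ≠ 0 → IsUnit a

section Definitions

variable {C : Type u} [Category.{v} C] [Abelian C]

/-! ### Monoform objects and the atom spectrum -/

/-- `X` and `Y` have a common nonzero subobject (up to isomorphism). -/
def HaveCommonSubobject (X Y : C) : Prop :=
  ∃ (L : C) (i : L ⟶ X) (j : L ⟶ Y), ¬ Limits.IsZero L ∧ Mono i ∧ Mono j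

/-- A nonzero object `H` is monoform if for every nonzero subobject `N` of `H`, the objects `H`
and `H / N` have no common nonzero subobject. -/
def IsMonoform (H : C) : Prop :=
  ¬ Limits.IsZero H ∧
    ∀ N : Subobject H, N ≠ ⊥ → ¬ HaveCommonSubobject H (Limits.cokernel N.arrow)

lemma subobject_ne_bot_iff {X : C} (N : Subobject X) : N ≠ ⊥ ↔ N.arrow ≠ 0 := by
  rw [not_iff_not]
  conv_lhs => rw [← Subobject.mk_arrow N]
  exact Subobject.mk_eq_bot_iff_zero

/-- A monoform object is uniform. -/
lemma IsMonoform.inf_ne_bot {H : C} (hH : IsMonoform H) (A B : Subobject H) (hA : A ≠ ⊥)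
    (hB : B ≠ ⊥) : A ⊓ B ≠ ⊥ := by
  intro h
  refine hH.2 B hB ⟨(A : C), A.arrow, A.arrow ≫ Limits.cokernel.π B.arrow, ?_, inferInstance, ?_⟩
  · intro hz
    exact (subobject_ne_bot_iff A).1 hA (hz.eq_of_src _ _)
  · refine Preadditive.mono_of_cancel_zero _ fun {G} g hg => ?_
    have h1 : (A ⊓ B).Factors (g ≫ A.arrow) := by
      rw [Subobject.inf_factors]
      refine ⟨Subobject.factors_comp_arrow g, ?_⟩
      have hk := (Abelian.monoIsKernelOfCokernel (Limits.CokernelCofork.ofπ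
        (Limits.cokernel.π B.arrow) (by simp)) (Limits.cokernelIsCokernel B.arrow))
      let l := Limits.KernelFork.IsLimit.lift' hk (g ≫ A.arrow) (by simpa using hg)
      have hl : l.1 ≫ B.arrow = g ≫ A.arrow := l.2
      rw [← hl]
      exact Subobject.factors_comp_arrow _
    rw [h, Subobject.bot_factors_iff_zero] at h1
    exact (cancel_mono A.arrow).1 (by simpa using h1)

variable (C) in
/-- The monoform objects of `C`. -/
abbrev Monoform : Type u := {H : C // IsMonoform H}

variable (C) in
/-- Atom equivalence of monoform objects. -/
instance atomSetoid : Setoid (Monoform C) where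
  r H H' := HaveCommonSubobject H.1 H'.1
  iseqv :=
    { refl := fun H => ⟨H.1, 𝟙 _, 𝟙 _, H.2.1, inferInstance, inferInstance⟩
      symm := fun ⟨L, i, j, hL, hi, hj⟩ => ⟨L, j, i, hL, hj, hi⟩
      trans := by
        rintro X Y Z ⟨L, i, j, hL, hi, hj⟩ ⟨L', i', j', hL', hi', hj'⟩
        have hne : ∀ {K : C} (k : K ⟶ Y.1) [Mono k], ¬ Limits.IsZero K → Subobject.mk k ≠ ⊥ := by
          intro K k _ hK hk
          rw [Subobject.mk_eq_bot_iff_zero] at hk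
          exact hK (Limits.IsZero.of_mono_eq_zero k hk)
        have hinf := Y.2.inf_ne_bot _ _ (hne j hL) (hne i' hL')
        let N : Subobject Y.1 := Subobject.mk j ⊓ Subobject.mk i'
        refine ⟨(N : C), Subobject.ofLEMk N j inf_le_left ≫ i,
          Subobject.ofLEMk N i' inf_le_right ≫ j', ?_, inferInstance, inferInstance⟩
        intro hz
        exact (subobject_ne_bot_iff N).1 hinf (hz.eq_of_src _ _) }

variable (C) in
/-- The atom spectrum: the monoform objects modulo atom equivalence. -/
def AtomSpectrum : Type u := Quotient (atomSetoid C)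

/-! ### Essential subobjects and injective hulls -/

/-- A subobject is essential if it meets every nonzero subobject. -/
def IsEssential {M : C} (N : Subobject M) : Prop :=
  ∀ L : Subobject M, L ≠ ⊥ → L ⊓ N ≠ ⊥

/-- `i : M ⟶ E` is an injective hull of `M`. -/
def IsInjectiveHull {M E : C} (i : M ⟶ E) : Prop :=
  Injective E ∧ ∃ _ : Mono i, IsEssential (Subobject.mk i)

/-- `E` is an injective hull of the atom `α`, that is, an injective hull of a monoform object
which represents `α`. -/
def AtomSpectrum.IsInjectiveHull (α : AtomSpectrum C) (E : C) : Prop :=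
  ∃ H : Monoform C, (Quotient.mk (atomSetoid C) H : AtomSpectrum C) = α ∧
    ∃ i : H.1 ⟶ E, Atoms.IsInjectiveHull i

lemma isEssential_iff {M : C} (N : Subobject M) : IsEssential N ↔
    ∀ ⦃Z : C⦄ (k : Z ⟶ M), k ≠ 0 → ∃ (W : C) (p : W ⟶ Z), p ≫ k ≠ 0 ∧ N.Factors (p ≫ k) := by
  constructor
  · intro hN Z k hk
    let A : Subobject M := Subobject.mk (Abelian.image.ι k)
    have hA : A ≠ ⊥ := by
      intro h
      rw [Subobject.mk_eq_bot_iff_zero] at h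
      apply hk
      rw [← Abelian.image.fac k, h, Limits.comp_zero]
    have hB := hN A hA
    let j : ((A ⊓ N : Subobject M) : C) ⟶ Abelian.image k :=
      Subobject.ofLEMk (A ⊓ N) (Abelian.image.ι k) inf_le_left
    have hj : j ≫ Abelian.image.ι k = (A ⊓ N).arrow := Subobject.ofLEMk_comp _
    let e := Abelian.factorThruImage k
    have hW : Limits.pullback.fst e j ≫ k = Limits.pullback.snd e j ≫ (A ⊓ N).arrow := by
      rw [← hj, ← reassoc_of% (Limits.pullback.condition (f := e) (g := j)), Abelian.image.fac]
    refine ⟨Limits.pullback e j, Limits.pullback.fst e j, ?_, ?_⟩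
    · rw [hW]
      intro h
      exact (subobject_ne_bot_iff _).1 hB ((cancel_epi _).1 (h.trans Limits.comp_zero.symm))
    · rw [hW]
      exact Subobject.factors_of_le _ inf_le_right (Subobject.factors_comp_arrow _)
  · intro h L hL hLN
    obtain ⟨W, p, h1, h2⟩ := h L.arrow ((subobject_ne_bot_iff L).1 hL)
    apply h1
    rw [← Subobject.bot_factors_iff_zero, ← hLN, Subobject.inf_factors]
    exact ⟨Subobject.factors_comp_arrow _, h2⟩

lemma isEssential_top (M : C) : IsEssential (⊤ : Subobject M) := by
  intro L hL
  rwa [inf_top_eq]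

lemma IsEssential.inf {M : C} {A B : Subobject M} (hA : IsEssential A) (hB : IsEssential B) :
    IsEssential (A ⊓ B) := by
  intro L hL
  rw [← inf_assoc]
  exact hB _ (hA _ hL)

lemma IsEssential.pullback {L M : C} (f : L ⟶ M) {N : Subobject M} (hN : IsEssential N) :
    IsEssential ((Subobject.pullback f).obj N) := by
  rw [isEssential_iff] at hN ⊢
  have key : ∀ ⦃W : C⦄ (q : W ⟶ L), N.Factors (q ≫ f) →
      ((Subobject.pullback f).obj N).Factors q := by
    intro W q hq
    have hp := Subobject.isPullback f N
    rw [← hp.lift_snd (N.factorThru _ hq) q (by simp)]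
    exact Subobject.factors_comp_arrow _
  intro Z k hk
  by_cases h : k ≫ f = 0
  · refine ⟨Z, 𝟙 Z, by simpa using hk, key _ ?_⟩
    rw [Category.id_comp, h]
    exact Subobject.factors_zero
  · obtain ⟨W, p, h1, h2⟩ := hN (k ≫ f) h
    refine ⟨W, p, fun h0 => h1 ?_, key _ (by simpa using h2)⟩
    rw [← Category.assoc, h0, Limits.zero_comp]

lemma IsEssential.trans {M : C} {N : Subobject M} (hN : IsEssential N) {A : Subobject (N : C)}
    (hA : IsEssential A) : IsEssential (Subobject.mk (A.arrow ≫ N.arrow)) := by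
  rw [isEssential_iff] at hN hA ⊢
  intro Z k hk
  obtain ⟨W, p, h1, h2⟩ := hN k hk
  have hq : N.factorThru _ h2 ≠ 0 := by
    intro h0
    apply h1
    rw [← N.factorThru_arrow _ h2, h0, Limits.zero_comp]
  obtain ⟨W', p', h3, h4⟩ := hA _ hq
  have hfac : (p' ≫ p) ≫ k = (p' ≫ N.factorThru _ h2) ≫ N.arrow := by simp
  refine ⟨W', p' ≫ p, ?_, ?_⟩
  · rw [hfac]
    intro h0
    exact h3 ((cancel_mono N.arrow).1 (by simpa using h0))
  · rw [hfac, ← A.factorThru_arrow _ h4, Category.assoc, Subobject.mk_factors_iff]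
    exact ⟨_, rfl⟩

/-! ### The spectral category -/

/-- The essential subobjects of `M`. -/
structure EssSub (M : C) where
  /-- the underlying subobject -/
  sub : Subobject M
  /-- it is essential -/
  isEssential : IsEssential sub

/-- The object underlying an essential subobject. -/
noncomputable abbrev EssSub.obj {M : C} (A : EssSub M) : C := (A.sub : C)

/-- The inclusion of an essential subobject. -/
noncomputable abbrev EssSub.ι {M : C} (A : EssSub M) : A.obj ⟶ M := A.sub.arrow

/-- The essential subobjects are ordered by reverse inclusion. -/
instance (M : C) : Preorder (EssSub M) where
  le A B := B.sub ≤ A.sub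
  le_refl A := le_refl A.sub
  le_trans _ _ _ h h' := le_trans h' h

/-- The whole object as an essential subobject. -/
abbrev EssSub.whole (M : C) : EssSub M := ⟨⊤, isEssential_top M⟩

instance (M : C) : Nonempty (EssSub M) := ⟨EssSub.whole M⟩

instance (M : C) : IsDirectedOrder (EssSub M) :=
  ⟨fun A B => ⟨⟨A.sub ⊓ B.sub, A.isEssential.inf B.isEssential⟩,
    (inf_le_left : A.sub ⊓ B.sub ≤ A.sub), (inf_le_right : A.sub ⊓ B.sub ≤ B.sub)⟩⟩

lemma EssSub.le_iff {M : C} {A B : EssSub M} : A ≤ B ↔ B.sub ≤ A.sub := Iff.rfl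

/-- The inclusion of a smaller essential subobject into a larger one. -/
noncomputable def EssSub.incl {M : C} {A B : EssSub M} (h : A ≤ B) : B.obj ⟶ A.obj :=
  Subobject.ofLE B.sub A.sub (EssSub.le_iff.1 h)

lemma EssSub.incl_ι {M : C} {A B : EssSub M} (h : A ≤ B) : incl h ≫ A.ι = B.ι :=
  Subobject.ofLE_arrow _

/-- Restriction of morphisms to a smaller essential subobject. -/
noncomputable def restr (M N : C) (A B : EssSub M) (h : A ≤ B) : (A.obj ⟶ N) →+ (B.obj ⟶ N) where
  toFun f := EssSub.incl h ≫ f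
  map_zero' := Limits.comp_zero
  map_add' _ _ := Preadditive.comp_add _ _ _ _ _ _

instance (M N : C) : DirectedSystem (fun A : EssSub M => (A.obj ⟶ N)) (restr M N · · ·) where
  map_self A x := by simp [restr, EssSub.incl]
  map_map _ _ _ _ _ x := by simp [restr, EssSub.incl]

/-- The direct limit of the groups `Hom(M', N)`, where `M'` runs over the essential subobjects
of `M`. -/
abbrev SpectralHom (M N : C) : Type (max u v) :=
  DirectLimit (fun A : EssSub M => (A.obj ⟶ N)) (restr M N)

/-- The class of a morphism defined on an essential subobject. -/
noncomputable def SpectralHom.mk {M N : C} (A : EssSub M) (f : A.obj ⟶ N) : SpectralHom M N := ⟦⟨A, f⟩⟧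

lemma SpectralHom.mk_eq {M N : C} {A B D : EssSub M} {a : A.obj ⟶ N} {b : B.obj ⟶ N}
    (p : D.obj ⟶ A.obj) (q : D.obj ⟶ B.obj) (hp : p ≫ A.ι = D.ι) (hq : q ≫ B.ι = D.ι)
    (h : p ≫ a = q ≫ b) : SpectralHom.mk A a = SpectralHom.mk B b := by
  have hA : A ≤ D := Subobject.le_of_comm p hp
  have hB : B ≤ D := Subobject.le_of_comm q hq
  refine Quotient.sound ⟨D, hA, hB, ?_⟩
  have h1 : p = EssSub.incl hA := (cancel_mono A.ι).1 (by rw [hp, EssSub.incl_ι])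
  have h2 : q = EssSub.incl hB := (cancel_mono B.ι).1 (by rw [hq, EssSub.incl_ι])
  rw [h1, h2] at h
  exact h

/-- For `f : A ⟶ M` and `B ⊆ M`, the inverse image `f⁻¹(B) ⊆ A`, as an essential subobject
of `L`. -/
noncomputable abbrev preimage {L M : C} (A : EssSub L) (f : A.obj ⟶ M) (B : EssSub M) : EssSub L :=
  ⟨Subobject.mk (((Subobject.pullback f).obj B.sub).arrow ≫ A.ι),
    A.isEssential.trans (B.isEssential.pullback f)⟩

/-- The inclusion `f⁻¹(B) ⟶ A`. -/
noncomputable def preimageι {L M : C} (A : EssSub L) (f : A.obj ⟶ M) (B : EssSub M) :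
    (preimage A f B).obj ⟶ A.obj :=
  (Subobject.underlyingIso _).hom ≫ ((Subobject.pullback f).obj B.sub).arrow

/-- The restriction `f' : f⁻¹(B) ⟶ B` of `f`. -/
noncomputable def preimageπ {L M : C} (A : EssSub L) (f : A.obj ⟶ M) (B : EssSub M) :
    (preimage A f B).obj ⟶ B.obj :=
  (Subobject.underlyingIso _).hom ≫ Subobject.pullbackπ f B.sub

lemma preimageι_ι {L M : C} (A : EssSub L) (f : A.obj ⟶ M) (B : EssSub M) :
    preimageι A f B ≫ A.ι = (preimage A f B).ι := by
  simp [preimageι]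

lemma preimageι_comp {L M : C} (A : EssSub L) (f : A.obj ⟶ M) (B : EssSub M) :
    preimageι A f B ≫ f = preimageπ A f B ≫ B.ι := by
  simp only [preimageι, preimageπ, Category.assoc]
  rw [(Subobject.isPullback f B.sub).w]

/-- The composite of representatives: the class of `f⁻¹(B) ⟶ B ⟶ N`. -/
noncomputable def compRep {L M N : C} (A : EssSub L) (f : A.obj ⟶ M) (B : EssSub M)
    (g : B.obj ⟶ N) : SpectralHom L N :=
  SpectralHom.mk (preimage A f B) (preimageπ A f B ≫ g)

lemma compRep_eq {L M N : C} {A : EssSub L} {f : A.obj ⟶ M} {B : EssSub M} {g : B.obj ⟶ N}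
    {D : EssSub L} (p : D.obj ⟶ A.obj) (q : D.obj ⟶ B.obj) (hp : p ≫ A.ι = D.ι)
    (hq : p ≫ f = q ≫ B.ι) : compRep A f B g = SpectralHom.mk D (q ≫ g) := by
  let l : D.obj ⟶ (preimage A f B).obj :=
    (Subobject.isPullback f B.sub).lift q p hq.symm ≫ (Subobject.underlyingIso _).inv
  have hl : l ≫ preimageι A f B = p := by simp [l, preimageι]
  have hl' : l ≫ preimageπ A f B = q := by simp [l, preimageπ]
  refine SpectralHom.mk_eq l (𝟙 _) ?_ (Category.id_comp _) ?_
  · rw [← preimageι_ι, reassoc_of% hl, hp]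
  · rw [reassoc_of% hl', Category.id_comp]

lemma compRep_restr {L M N : C} {A A' : EssSub L} (hA : A ≤ A') (f : A.obj ⟶ M) {B B' : EssSub M}
    (hB : B ≤ B') (g : B.obj ⟶ N) :
    compRep A f B g = compRep A' (restr L M A A' hA f) B' (restr M N B B' hB g) := by
  rw [compRep_eq (D := preimage A' (restr L M A A' hA f) B')
    (preimageι _ _ _ ≫ EssSub.incl hA)
    (preimageπ _ _ _ ≫ EssSub.incl hB)]
  · simp [compRep, restr]
  · rw [Category.assoc, EssSub.incl_ι]
    exact preimageι_ι _ _ _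
  · rw [Category.assoc, Category.assoc, EssSub.incl_ι]
    exact preimageι_comp _ _ _

/-- Composition in the spectral category. -/
noncomputable def SpectralHom.comp {L M N : C} (x : SpectralHom L M) (y : SpectralHom M N) :
    SpectralHom L N :=
  Quotient.liftOn₂ x y (fun a b => compRep a.1 a.2 b.1 b.2) (by
    rintro a b a' b' ⟨A, h1, h2, h⟩ ⟨B, h3, h4, h'⟩
    rw [compRep_restr h1 a.2 h3 b.2, compRep_restr h2 a'.2 h4 b'.2, h, h'])

lemma SpectralHom.mk_comp_mk {L M N : C} {A : EssSub L} {f : A.obj ⟶ M} {B : EssSub M}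
    {g : B.obj ⟶ N} {D : EssSub L} (p : D.obj ⟶ A.obj) (q : D.obj ⟶ B.obj) (hp : p ≫ A.ι = D.ι)
    (hq : p ≫ f = q ≫ B.ι) : (mk A f).comp (mk B g) = mk D (q ≫ g) :=
  compRep_eq p q hp hq

/-- The class in the direct limit of a morphism defined on the whole object. -/
noncomputable def SpectralHom.of {M N : C} (f : M ⟶ N) : SpectralHom M N :=
  mk (EssSub.whole M) ((⊤ : Subobject M).arrow ≫ f)

lemma SpectralHom.of_eq_mk {M N : C} (f : M ⟶ N) (A : EssSub M) : of f = mk A (A.ι ≫ f) :=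
  mk_eq (D := A) (EssSub.incl (A := EssSub.whole M) (EssSub.le_iff.2 le_top)) (𝟙 _)
    (EssSub.incl_ι _) (Category.id_comp _)
    (by rw [Category.id_comp, ← Category.assoc]; exact congrArg (· ≫ f) (EssSub.incl_ι _))

lemma SpectralHom.of_comp_mk {L M N : C} (f : L ⟶ M) {B : EssSub M} (g : B.obj ⟶ N) {D : EssSub L}
    (q : D.obj ⟶ B.obj) (h : D.ι ≫ f = q ≫ B.ι) : (of f).comp (mk B g) = mk D (q ≫ g) := by
  rw [of_eq_mk f D]
  exact mk_comp_mk (𝟙 _) q (Category.id_comp _) (by simpa using h)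

lemma SpectralHom.mk_comp_of {L M N : C} {A : EssSub L} (f : A.obj ⟶ M) (g : M ⟶ N) :
    (mk A f).comp (of g) = mk A (f ≫ g) := by
  refine (mk_comp_mk (D := A) (𝟙 _) (Subobject.factorThru ⊤ f (Subobject.top_factors f))
    (Category.id_comp _) ?_).trans ?_
  · simp
  · simp

lemma exists_preimage {L M : C} (A : EssSub L) (f : A.obj ⟶ M) (B : EssSub M) :
    ∃ (D : EssSub L) (p : D.obj ⟶ A.obj) (q : D.obj ⟶ B.obj), p ≫ A.ι = D.ι ∧ p ≫ f = q ≫ B.ι :=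
  ⟨preimage A f B, preimageι A f B, preimageπ A f B, preimageι_ι A f B, preimageι_comp A f B⟩

lemma SpectralHom.comp_assoc {K L M N : C} (x : SpectralHom K L) (y : SpectralHom L M)
    (z : SpectralHom M N) : (x.comp y).comp z = x.comp (y.comp z) := by
  obtain ⟨A, f, rfl⟩ := DirectLimit.exists_eq_mk _ x
  obtain ⟨B, g, rfl⟩ := DirectLimit.exists_eq_mk _ y
  obtain ⟨D, h, rfl⟩ := DirectLimit.exists_eq_mk _ z
  change ((mk A f).comp (mk B g)).comp (mk D h) = (mk A f).comp ((mk B g).comp (mk D h))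
  obtain ⟨Z₁, p₁, q₁, hp₁, hq₁⟩ := exists_preimage A f B
  obtain ⟨Z₂, p₂, q₂, hp₂, hq₂⟩ := exists_preimage Z₁ (q₁ ≫ g) D
  obtain ⟨W, r, s, hr, hs⟩ := exists_preimage B g D
  obtain ⟨Z₃, p₃, q₃, hp₃, hq₃⟩ := exists_preimage Z₂ (p₂ ≫ q₁ ≫ B.ι) W
  have e₃ : p₃ ≫ p₂ ≫ q₁ = q₃ ≫ r := by
    refine (cancel_mono B.ι).1 ?_
    simp only [Category.assoc, hr, hq₃]
  have e₄ : p₃ ≫ q₂ = q₃ ≫ s := by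
    refine (cancel_mono D.ι).1 ?_
    rw [Category.assoc, Category.assoc, ← hq₂, ← hs, ← reassoc_of% e₃]
  rw [mk_comp_mk p₁ q₁ hp₁ hq₁, mk_comp_mk r s hr hs,
    mk_comp_mk (D := Z₃) (p₃ ≫ p₂) (p₃ ≫ q₂)
      (by rw [Category.assoc, hp₂, hp₃]) (by simp only [Category.assoc, hq₂]),
    mk_comp_mk (D := Z₃) (p₃ ≫ p₂ ≫ p₁) q₃
      (by simp only [Category.assoc, hp₁, hp₂, hp₃])
      (by simp only [Category.assoc, hq₁, hq₃]), e₄, Category.assoc]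

lemma SpectralHom.exists_mk {M N : C} (x : SpectralHom M N) :
    ∃ (A : EssSub M) (f : A.obj ⟶ N), x = mk A f :=
  DirectLimit.exists_eq_mk _ x

lemma SpectralHom.exists_mk₂ {M N : C} (x y : SpectralHom M N) :
    ∃ (A : EssSub M) (f g : A.obj ⟶ N), x = mk A f ∧ y = mk A g :=
  DirectLimit.exists_eq_mk₂ _ x y

lemma SpectralHom.mk_add_mk {M N : C} (A : EssSub M) (f g : A.obj ⟶ N) :
    mk A f + mk A g = mk A (f + g) :=
  DirectLimit.add_def (G := fun A : EssSub M => (A.obj ⟶ N)) (f := restr M N) A f g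

end Definitions

/-- The spectral category of `C`: same objects, and morphisms `SpectralHom`. -/
structure SpectralCategory (C : Type u) where
  /-- the underlying object of `C` -/
  obj : C

variable (C : Type u) [Category.{v} C] [Abelian C]

noncomputable instance : Category.{max u v} (SpectralCategory C) where
  Hom M N := SpectralHom M.obj N.obj
  id M := SpectralHom.of (𝟙 M.obj)
  comp x y := SpectralHom.comp x y
  id_comp x := by
    obtain ⟨A, f, rfl⟩ := SpectralHom.exists_mk x
    rw [SpectralHom.of_comp_mk (D := A) _ f (𝟙 _) (by simp), Category.id_comp]
  comp_id x := by
    obtain ⟨A, f, rfl⟩ := SpectralHom.exists_mk x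
    rw [SpectralHom.mk_comp_of, Category.comp_id]
  assoc x y z := SpectralHom.comp_assoc x y z

noncomputable instance : Preadditive (SpectralCategory C) where
  homGroup M N := inferInstanceAs (AddCommGroup (SpectralHom M.obj N.obj))
  add_comp L M N x y z := by
    obtain ⟨A, f, g, rfl, rfl⟩ := SpectralHom.exists_mk₂ x y
    obtain ⟨B, h, rfl⟩ := SpectralHom.exists_mk z
    change (SpectralHom.mk A f + SpectralHom.mk A g).comp (SpectralHom.mk B h) =
      (SpectralHom.mk A f).comp (SpectralHom.mk B h) +
        (SpectralHom.mk A g).comp (SpectralHom.mk B h)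
    let Z₁ := preimage A f B
    let p := preimageι Z₁ (preimageι A f B ≫ g) B
    let r := preimageπ Z₁ (preimageι A f B ≫ g) B
    have hp : (p ≫ preimageι A f B) ≫ A.ι = (preimage Z₁ (preimageι A f B ≫ g) B).ι := by
      rw [Category.assoc, preimageι_ι]
      exact preimageι_ι _ _ _
    have hf : (p ≫ preimageι A f B) ≫ f = (p ≫ preimageπ A f B) ≫ B.ι := by
      rw [Category.assoc, Category.assoc, preimageι_comp]
    have hg : (p ≫ preimageι A f B) ≫ g = r ≫ B.ι := by
      rw [Category.assoc]
      exact preimageι_comp _ _ _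
    rw [SpectralHom.mk_add_mk, SpectralHom.mk_comp_mk _ _ hp hf, SpectralHom.mk_comp_mk _ _ hp hg,
      SpectralHom.mk_comp_mk _ (p ≫ preimageπ A f B + r) hp
        (by rw [Preadditive.comp_add, Preadditive.add_comp, hf, hg]),
      SpectralHom.mk_add_mk, Preadditive.add_comp]
  comp_add L M N x y z := by
    obtain ⟨A, f, rfl⟩ := SpectralHom.exists_mk x
    obtain ⟨B, g, h, rfl, rfl⟩ := SpectralHom.exists_mk₂ y z
    change (SpectralHom.mk A f).comp (SpectralHom.mk B g + SpectralHom.mk B h) =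
      (SpectralHom.mk A f).comp (SpectralHom.mk B g) +
        (SpectralHom.mk A f).comp (SpectralHom.mk B h)
    have hp := preimageι_ι A f B
    have hq := preimageι_comp A f B
    rw [SpectralHom.mk_add_mk, SpectralHom.mk_comp_mk _ _ hp hq, SpectralHom.mk_comp_mk _ _ hp hq,
      SpectralHom.mk_comp_mk _ _ hp hq, SpectralHom.mk_add_mk, Preadditive.comp_add]

/-- The canonical functor from `C` to its spectral category. -/
noncomputable def toSpectral : C ⥤ SpectralCategory C where
  obj M := ⟨M⟩
  map f := SpectralHom.of f
  map_id _ := rfl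
  map_comp _ _ := ((SpectralHom.mk_comp_of _ _).trans
    (congrArg (SpectralHom.mk _) (Category.assoc _ _ _))).symm

instance : (toSpectral C).Additive where
  map_add {_ _ f g} := (congrArg (SpectralHom.mk _) (Preadditive.comp_add _ _ _ _ f g)).trans
    (SpectralHom.mk_add_mk _ _ _).symm

end Atoms

namespace Atoms

open Limits

/-! Let `E` be an injective hull of a monoform object `H`. Since `H` is uniform and essential in
`E`, every nonzero subobject of `E` is essential, so an endomorphism becomes zero in the spectral
category exactly when it is not mono (`IsUniform.spectralEnd_eq_zero_iff`). A monomorphism `E ⟶ E`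
splits by injectivity and is then an isomorphism by uniformity. Hence `spectralEnd` has the
non-units as kernel; it is surjective because morphisms from essential subobjects extend to `E`.
This gives the skew field, the local ring and the second isomorphism.

The largest monoform subobject is the intersection of the kernels of all non-mono endomorphisms: a
nonzero subobject is monoform iff all of these kill it (`IsUniform.isMonoform_iff`). Restriction to
it is a surjection from `End E` with the same kernel as `spectralEnd`, whence the first isomorphism.

Existence of hulls is the classical argument: a maximal essential extension inside an injective
object is a direct summand. -/

lemma mk_factors_iff {C : Type u} [Category.{v} C] {X Y W : C} {f : X ⟶ Y} [Mono f]
    {k : W ⟶ Y} :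
    (Subobject.mk f).Factors k ↔ ∃ q : W ⟶ X, q ≫ f = k :=
  Subobject.mk_factors_iff f k

/-! ### Directed unions of subobjects and AB5 -/

section Directed

variable {C : Type u} [Category.{v} C] [Abelian C] [IsGrothendieckAbelian.{w} C]

/-- A directed family of subobjects of `X` which stay subobjects along `f : X ⟶ Y`. -/
noncomputable def directedMonoOver {J : Type w} [Preorder J] {X Y : C} (s : J →o Subobject X)
    (f : X ⟶ Y) (h : ∀ j, Mono ((s j).arrow ≫ f)) : J ⥤ MonoOver Y where
  obj j := haveI := h j; MonoOver.mk ((s j).arrow ≫ f)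
  map {i j} g := haveI := h i; haveI := h j
    MonoOver.homMk (Subobject.ofLE (s i) (s j) (s.monotone (leOfHom g))) (by simp)

/-- By AB5, a directed union is the colimit of its members, and a filtered colimit of subobjects of
`Y` is a subobject of `Y`. -/
lemma mono_iSup_arrow_comp {J : Type w} [Preorder J] [IsDirectedOrder J] [Nonempty J] {X Y : C}
    (s : J →o Subobject X) (f : X ⟶ Y) (h : ∀ j, Mono ((s j).arrow ≫ f)) :
    Mono ((⨆ j, s j).arrow ≫ f) := by
  have h' : ∀ j, Mono ((s j).arrow ≫ 𝟙 X) := fun j => by rw [Category.comp_id]; infer_instance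
  let F := directedMonoOver s (𝟙 X) h'
  let D := F ⋙ MonoOver.forget X ⋙ Over.forget X
  let G := directedMonoOver s f h
  let d : colimit D ⟶ X := colimit.desc D
    (Cocone.mk X { app := fun j => (F.obj j).obj.hom, naturality := fun i j g => by simp [D] })
  have hd : ∀ j, colimit.ι D j ≫ d = (F.obj j).obj.hom := fun j => colimit.ι_desc _ _
  have hm : Mono d := IsGrothendieckAbelian.mono_of_isColimit_monoOver F (colimit.isColimit D) d hd
  have hs := IsGrothendieckAbelian.subobjectMk_of_isColimit_eq_iSup F (colimit.isColimit D) d hd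
  have hF : ∀ j, (F.obj j).obj.hom = (s j).arrow := fun j => Category.comp_id _
  -- `F` and `G` have the same underlying diagram in `C`, so the colimit of `D` also serves for `G`.
  have hdf : Mono (d ≫ f) :=
    IsGrothendieckAbelian.mono_of_isColimit_monoOver G (c := colimit.cocone D)
      (colimit.isColimit D) (d ≫ f) (fun j => by
        change colimit.ι D j ≫ d ≫ f = (s j).arrow ≫ f
        rw [← hF j, ← hd j]
        exact (Category.assoc _ _ _).symm)
  have e : (⨆ j, s j) = Subobject.mk d := by
    refine Eq.trans (iSup_congr fun j => ?_) hs.symm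
    refine (Subobject.mk_arrow (s j)).symm.trans ?_
    congr 1
    exact (hF j).symm
  rw [e]
  have : (Subobject.mk d).arrow ≫ f = (Subobject.underlyingIso d).hom ≫ d ≫ f := by
    rw [← Category.assoc, Subobject.underlyingIso_hom_comp_eq_mk]
  rw [this]
  infer_instance

/-- The subobjects of `X` form a `w`-small set, so `c` can be reindexed by a type in `Type w`. -/
lemma mono_sSup_arrow_comp {X Y : C} {c : Set (Subobject X)} (hne : c.Nonempty)
    (hc : DirectedOn (· ≤ ·) c) (f : X ⟶ Y) (h : ∀ s ∈ c, Mono (s.arrow ≫ f)) :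
    Mono ((sSup c).arrow ≫ f) := by
  let e := orderIsoShrink.{w} c
  let s : Shrink.{w} c →o Subobject X :=
    ⟨fun j => (e.symm j).1, fun i j hij => e.symm.monotone hij⟩
  have : Nonempty c := hne.to_subtype
  have : Nonempty (Shrink.{w} c) := ⟨e this.some⟩
  have hd : IsDirectedOrder c := ⟨(directedOn_iff_directed.1 hc)⟩
  have : IsDirectedOrder (Shrink.{w} c) := ⟨fun a b => by
    obtain ⟨z, h1, h2⟩ := hd.directed (e.symm a) (e.symm b)
    exact ⟨e z, by rwa [← e.symm_apply_le], by rwa [← e.symm_apply_le]⟩⟩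
  have hs : (⨆ j, s j) = sSup c := by
    rw [sSup_eq_iSup']
    exact e.symm.toEquiv.iSup_congr (fun _ => rfl)
  rw [← hs]
  exact mono_iSup_arrow_comp s f fun j => h _ (e.symm j).2

end Directed

/-! ### Intersections of subobjects -/

section Lattice

variable {C : Type u} [Category.{v} C] [Abelian C]

/-- The kernel of `S ⟶ X / L` is `L ⊓ S`. Trivial intersection thus becomes monicity, the form in
which AB5 applies. -/
lemma inf_eq_bot_iff_mono {X : C} (L S : Subobject X) :
    L ⊓ S = ⊥ ↔ Mono (S.arrow ≫ cokernel.π L.arrow) := by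
  have key : ∀ {W : C} (k : W ⟶ X), L.Factors k ↔ k ≫ cokernel.π L.arrow = 0 := by
    intro W k
    refine ⟨fun h => ?_, fun h => ?_⟩
    · rw [← L.factorThru_arrow k h, Category.assoc, cokernel.condition, comp_zero]
    · rw [← Abelian.monoLift_comp L.arrow k h]
      exact Subobject.factors_comp_arrow _
  refine ⟨fun h => Preadditive.mono_of_cancel_zero _ fun {W} g hg => ?_, fun h => ?_⟩
  · have h1 : (L ⊓ S).Factors (g ≫ S.arrow) := by
      rw [Subobject.inf_factors]
      exact ⟨(key _).2 (by simpa using hg), Subobject.factors_comp_arrow g⟩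
    rw [h, Subobject.bot_factors_iff_zero] at h1
    exact (cancel_mono S.arrow).1 (by simpa using h1)
  · by_contra hne
    apply (subobject_ne_bot_iff _).1 hne
    have h1 : Subobject.ofLE (L ⊓ S) S inf_le_right = 0 := by
      rw [← cancel_mono (S.arrow ≫ cokernel.π L.arrow), zero_comp, Subobject.ofLE_arrow_assoc]
      exact (key _).1 (Subobject.inf_arrow_factors_left _ _)
    rw [← Subobject.ofLE_arrow (inf_le_right : L ⊓ S ≤ S), h1, zero_comp]

lemma inf_ne_bot_of_factors {X W : C} {A B : Subobject X} (k : W ⟶ X) (hk : k ≠ 0)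
    (hA : A.Factors k) (hB : B.Factors k) : A ⊓ B ≠ ⊥ := by
  intro h
  apply hk
  rw [← Subobject.bot_factors_iff_zero, ← h, Subobject.inf_factors]
  exact ⟨hA, hB⟩

end Lattice

/-! ### Existence of injective hulls -/

section Hull

variable {C : Type u} [Category.{v} C] [Abelian C] [IsGrothendieckAbelian.{w} C]

lemma eq_bot_of_le_sSup {X : C} {c : Set (Subobject X)} (hne : c.Nonempty)
    (hc : DirectedOn (· ≤ ·) c) {L : Subobject X} (hL : L ≤ sSup c)
    (h : ∀ s ∈ c, L ⊓ s = ⊥) : L = ⊥ := by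
  have := (inf_eq_bot_iff_mono L (sSup c)).2
    (mono_sSup_arrow_comp hne hc _ fun s hs => (inf_eq_bot_iff_mono L s).1 (h s hs))
  rwa [inf_eq_left.2 hL] at this

/-- The predicate says that `H` is essential in `E`, phrased inside the lattice of `X` so that
Zorn's lemma applies there. -/
lemma exists_maximal_essential {X : C} (H : Subobject X) :
    ∃ E, H ≤ E ∧ Maximal (fun E => ∀ L ≤ E, L ≠ ⊥ → L ⊓ H ≠ ⊥) E := by
  refine zorn_le_nonempty₀ {E : Subobject X | ∀ L ≤ E, L ≠ ⊥ → L ⊓ H ≠ ⊥}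
    (fun c hcs hc y hy => ⟨sSup c, fun L hL hL0 h => hL0 ?_, fun _ => le_sSup⟩) H
    fun L hL hL0 => by rwa [inf_eq_left.2 hL]
  refine eq_bot_of_le_sSup ⟨y, hy⟩ hc.directedOn hL fun s hs => ?_
  by_contra hne
  exact hcs hs _ inf_le_right hne (by rw [inf_right_comm, h, bot_inf_eq])

lemma exists_maximal_inf_eq_bot {X : C} (E : Subobject X) :
    ∃ K, Maximal (fun K => K ⊓ E = ⊥) K := by
  refine zorn_le₀ {K : Subobject X | K ⊓ E = ⊥} fun c hcs hc => ?_
  obtain rfl | ⟨y, hy⟩ := c.eq_empty_or_nonempty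
  · exact ⟨⊥, bot_inf_eq E, by simp⟩
  · refine ⟨sSup c, eq_bot_of_le_sSup ⟨y, hy⟩ hc.directedOn inf_le_left fun s hs => ?_,
      fun _ => le_sSup⟩
    rw [inf_right_comm, inf_eq_right.2 (le_sSup hs)]
    exact hcs hs

/-- The preimage of a nonzero `L` in `X / K` is strictly larger than `K`, so by maximality it meets
`E`; the image of that intersection lies in both `L` and `E`. -/
lemma isEssential_mk_of_maximal {X : C} {E K : Subobject X} (hK : Maximal (fun K => K ⊓ E = ⊥) K)
    [Mono (E.arrow ≫ cokernel.π K.arrow)] :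
    IsEssential (Subobject.mk (E.arrow ≫ cokernel.π K.arrow)) := by
  intro L hL
  let π := cokernel.π K.arrow
  let K' := (Subobject.pullback π).obj L
  have hp := Subobject.isPullback π L
  have hepi : Epi (Subobject.pullbackπ π L) := by
    exact Abelian.epi_fst_of_isLimit (f := L.arrow) π hp.isLimit
  have hle : K ≤ K' := by
    refine Subobject.le_of_comm (hp.lift 0 K.arrow (by simp [π])) ?_
    exact hp.lift_snd _ _ _
  have hne : K' ⊓ E ≠ ⊥ := by
    intro h
    have hle' := hK.le_of_ge h hle
    apply (subobject_ne_bot_iff L).1 hL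
    rw [← cancel_epi (Subobject.pullbackπ π L), hp.w, comp_zero, ← Subobject.ofLE_arrow hle',
      Category.assoc, cokernel.condition, comp_zero]
  let m := (K' ⊓ E).arrow
  have hm : m ≠ 0 := (subobject_ne_bot_iff _).1 hne
  let b := Subobject.ofLE (K' ⊓ E) E inf_le_right
  have hb : b ≫ E.arrow = m := Subobject.ofLE_arrow _
  refine inf_ne_bot_of_factors (m ≫ π) ?_ ?_ ?_
  · rw [← hb, Category.assoc]
    intro h0
    have : b = 0 := by
      rw [← cancel_mono (E.arrow ≫ π), h0, zero_comp]
    apply hm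
    rw [← hb, this, zero_comp]
  · have : m ≫ π = (Subobject.ofLE (K' ⊓ E) K' inf_le_left ≫ Subobject.pullbackπ π L) ≫ L.arrow := by
      rw [Category.assoc, hp.w, Subobject.ofLE_arrow_assoc]
    rw [this]
    exact Subobject.factors_comp_arrow _
  · rw [mk_factors_iff]
    exact ⟨b, by rw [← hb, Category.assoc]⟩

/-- With `K` a maximal complement of `E`, the inclusion of `E` extends along `E ⟶ X / K` to `g : X /
K ⟶ X`. As `E` is essential in `X / K`, `g` is mono and its image is an essential extension of `H`
containing `E`. Maximality makes that image `E`, so `E` is a retract of `X`. -/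
lemma injective_of_maximal_essential {X : C} [Injective X] {H E : Subobject X}
    (hE : Maximal (fun E => ∀ L ≤ E, L ≠ ⊥ → L ⊓ H ≠ ⊥) E) : Injective (E : C) := by
  obtain ⟨K, hK⟩ := exists_maximal_inf_eq_bot E
  let π := cokernel.π K.arrow
  have hmono : Mono (E.arrow ≫ π) := (inf_eq_bot_iff_mono K E).1 hK.prop
  have hess := (isEssential_iff _).1 (isEssential_mk_of_maximal hK)
  let g := Injective.factorThru E.arrow (E.arrow ≫ π)
  have hg : (E.arrow ≫ π) ≫ g = E.arrow := Injective.comp_factorThru _ _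
  have hgm : Mono g := by
    refine Preadditive.mono_of_cancel_zero _ fun {W} k hk => ?_
    by_contra hne
    obtain ⟨V, p, h1, h2⟩ := hess k hne
    obtain ⟨q, hq⟩ := mk_factors_iff.1 h2
    apply h1
    have : q = 0 := by
      rw [← cancel_mono E.arrow, zero_comp, ← hg, ← Category.assoc, hq, Category.assoc, hk,
        comp_zero]
    rw [← hq, this, zero_comp]
  have hle : E ≤ Subobject.mk g := by
    refine Subobject.le_of_comm ((E.arrow ≫ π) ≫ (Subobject.underlyingIso g).inv) ?_
    rw [Category.assoc, Subobject.underlyingIso_arrow, hg]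
  have hmax : Subobject.mk g ≤ E := by
    refine hE.le_of_ge (fun L hL hL0 h => ?_) hle
    let l := Subobject.ofLEMk L g hL
    have hl : l ≫ g = L.arrow := Subobject.ofLEMk_comp _
    have hl0 : l ≠ 0 := fun h0 => (subobject_ne_bot_iff L).1 hL0 (by rw [← hl, h0, zero_comp])
    obtain ⟨V, p, h1, h2⟩ := hess l hl0
    obtain ⟨q, hq⟩ := mk_factors_iff.1 h2
    have hLE : L ⊓ E ≠ ⊥ := by
      refine inf_ne_bot_of_factors (p ≫ L.arrow) ?_ (Subobject.factors_comp_arrow _) ?_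
      · rw [← hl, ← Category.assoc]
        intro h0
        exact h1 ((cancel_mono g).1 (by rw [h0, zero_comp]))
      · rw [← hl, ← Category.assoc, ← hq, Category.assoc, hg]
        exact Subobject.factors_comp_arrow _
    refine hE.prop _ inf_le_right hLE ?_
    rw [inf_right_comm, h, bot_inf_eq]
  let t := Subobject.ofMkLE g E hmax
  have ht : t ≫ E.arrow = g := Subobject.ofMkLE_arrow _
  refine Retract.injective (Y := X) ⟨E.arrow, π ≫ t, ?_⟩
  rw [← cancel_mono E.arrow, Category.assoc, Category.assoc, ht, ← Category.assoc, hg,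
    Category.id_comp]

lemma exists_isInjectiveHull (H : C) : ∃ (E : C) (i : H ⟶ E), IsInjectiveHull i := by
  let j := Injective.ι H
  obtain ⟨E, hHE, hE⟩ := exists_maximal_essential (Subobject.mk j)
  let i := Subobject.ofMkLE j E hHE
  have hi : i ≫ E.arrow = j := Subobject.ofMkLE_arrow _
  have hm : Mono i := inferInstance
  refine ⟨E, i, injective_of_maximal_essential hE, hm, fun L hL => ?_⟩
  have hL' : Subobject.mk (L.arrow ≫ E.arrow) ≠ ⊥ := by
    rw [Ne, Subobject.mk_eq_bot_iff_zero]
    intro h0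
    exact (subobject_ne_bot_iff L).1 hL ((cancel_mono E.arrow).1 (by rw [h0, zero_comp]))
  have h := hE.prop _ (Subobject.mk_le_of_comm L.arrow rfl) hL'
  let M := Subobject.mk (L.arrow ≫ E.arrow) ⊓ Subobject.mk j
  let a := Subobject.ofLEMk M (L.arrow ≫ E.arrow) inf_le_left
  let b := Subobject.ofLEMk M j inf_le_right
  have ha : a ≫ L.arrow ≫ E.arrow = M.arrow := Subobject.ofLEMk_comp _
  have hb : b ≫ j = M.arrow := Subobject.ofLEMk_comp _
  have hab : a ≫ L.arrow = b ≫ i := by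
    rw [← cancel_mono E.arrow, Category.assoc, ha, Category.assoc, hi, hb]
  refine inf_ne_bot_of_factors (a ≫ L.arrow) (fun h0 => (subobject_ne_bot_iff M).1 h ?_)
    (Subobject.factors_comp_arrow _) ?_
  · rw [← ha, ← Category.assoc, h0, zero_comp]
  · rw [mk_factors_iff, hab]
    exact ⟨b, rfl⟩

lemma AtomSpectrum.exists_isInjectiveHull (α : AtomSpectrum C) : ∃ E : C, α.IsInjectiveHull E := by
  obtain ⟨H, rfl⟩ := Quotient.exists_rep α
  obtain ⟨E, i, hi⟩ := Atoms.exists_isInjectiveHull H.1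
  exact ⟨E, H, rfl, i, hi⟩

end Hull

/-! ### Endomorphisms in the spectral category -/

section Spectral

variable {C : Type u} [Category.{v} C] [Abelian C]

lemma SpectralHom.of_eq_zero_iff {M N : C} (f : M ⟶ N) :
    (of f : SpectralHom M N) = 0 ↔ ∃ A : EssSub M, A.ι ≫ f = 0 := by
  have h0 : (0 : SpectralHom M N) = of 0 := ((toSpectral C).map_zero M N).symm
  rw [h0]
  constructor
  · intro h
    obtain ⟨A, h1, h2, h⟩ := Quotient.exact h
    refine ⟨A, ?_⟩
    have h : EssSub.incl h1 ≫ (EssSub.whole M).ι ≫ f = EssSub.incl h2 ≫ (EssSub.whole M).ι ≫ 0 := h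
    rwa [← Category.assoc, EssSub.incl_ι, comp_zero, comp_zero] at h
  · rintro ⟨A, h⟩
    rw [of_eq_mk f A, of_eq_mk 0 A, h, comp_zero]

variable (C) in
/-- The action of the canonical functor to the spectral category on an endomorphism ring. -/
noncomputable def spectralEnd (E : C) : End E →+* End ((toSpectral C).obj E) :=
  { (toSpectral C).mapEnd E with
    map_zero' := (toSpectral C).map_zero E E
    map_add' := fun _ _ => (toSpectral C).map_add }

lemma spectralEnd_surjective (E : C) [Injective E] : Function.Surjective (spectralEnd C E) := by
  intro x
  obtain ⟨A, f, rfl⟩ := SpectralHom.exists_mk (M := E) (N := E) x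
  refine ⟨(Injective.factorThru f A.ι : E ⟶ E), ?_⟩
  refine (SpectralHom.of_eq_mk _ A).trans ?_
  rw [Injective.comp_factorThru]

end Spectral

/-! ### Uniform injective objects and their endomorphism rings -/

section Uniform

variable {C : Type u} [Category.{v} C] [Abelian C]

/-- A nonzero object is uniform if any two nonzero subobjects meet. -/
structure IsUniform (E : C) : Prop where
  not_isZero : ¬ IsZero E
  inf_ne_bot : ∀ A B : Subobject E, A ≠ ⊥ → B ≠ ⊥ → A ⊓ B ≠ ⊥

/-- Nonzero subobjects of `E` have nonzero traces on the essential subobject `H`, and these traces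
meet because `H` is uniform. -/
lemma isUniform_of_isEssential {H E : C} (hH : IsMonoform H) (i : H ⟶ E) [Mono i]
    (hi : IsEssential (Subobject.mk i)) : IsUniform E := by
  refine ⟨fun h => hH.1 (h.of_mono i), fun A B hA hB => ?_⟩
  have key : ∀ A : Subobject E, A ≠ ⊥ → (Subobject.pullback i).obj A ≠ ⊥ := by
    intro A hA h
    let M := A ⊓ Subobject.mk i
    apply (subobject_ne_bot_iff M).1 (hi A hA)
    let a := Subobject.ofLE M A inf_le_left
    let b := Subobject.ofLEMk M i inf_le_right
    have hb : b ≫ i = M.arrow := Subobject.ofLEMk_comp _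
    have hab : a ≫ A.arrow = b ≫ i := (Subobject.ofLE_arrow _).trans hb.symm
    have hA : ((Subobject.pullback i).obj A).Factors b := by
      rw [← (Subobject.isPullback i A).lift_snd a b hab]
      exact Subobject.factors_comp_arrow _
    rw [h, Subobject.bot_factors_iff_zero] at hA
    rw [← hb, hA, zero_comp]
  have h := hH.inf_ne_bot _ _ (key A hA) (key B hB)
  let M := (Subobject.pullback i).obj A ⊓ (Subobject.pullback i).obj B
  refine inf_ne_bot_of_factors (M.arrow ≫ i) ?_ ?_ ?_
  · intro h0
    exact (subobject_ne_bot_iff M).1 h ((cancel_mono i).1 (by rw [h0, zero_comp]))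
  · have : M.arrow ≫ i = (Subobject.ofLE M _ inf_le_left ≫ Subobject.pullbackπ i A) ≫ A.arrow := by
      rw [Category.assoc, (Subobject.isPullback i A).w, Subobject.ofLE_arrow_assoc]
    rw [this]
    exact Subobject.factors_comp_arrow _
  · have : M.arrow ≫ i = (Subobject.ofLE M _ inf_le_right ≫ Subobject.pullbackπ i B) ≫ B.arrow := by
      rw [Category.assoc, (Subobject.isPullback i B).w, Subobject.ofLE_arrow_assoc]
    rw [this]
    exact Subobject.factors_comp_arrow _

lemma kernelSubobject_ne_bot_iff {X Y : C} (f : X ⟶ Y) : kernelSubobject f ≠ ⊥ ↔ ¬ Mono f := by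
  refine not_congr ⟨fun h => Preadditive.mono_of_cancel_zero _ fun g hg => ?_, fun h => ?_⟩
  · rwa [← Subobject.bot_factors_iff_zero, ← h, kernelSubobject_factors_iff]
  · by_contra hne
    exact (subobject_ne_bot_iff _).1 hne ((cancel_mono f).1 (by
      rw [kernelSubobject_arrow_comp, zero_comp]))

namespace IsUniform

variable {E : C} (hE : IsUniform E)
include hE

lemma isEssential {A : Subobject E} (hA : A ≠ ⊥) : IsEssential A :=
  fun L hL => hE.inf_ne_bot L A hL hA

/-- A retraction `r` of `f` has kernel meeting the nonzero image of `f` trivially. Uniformity makes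
`r` mono, hence a two-sided inverse. -/
lemma isUnit_iff_mono [Injective E] (f : End E) : IsUnit f ↔ Mono f.asHom := by
  rw [isUnit_iff_isIso]
  refine ⟨fun _ => inferInstance, fun _ => ?_⟩
  let f' : E ⟶ E := f
  let r := Injective.factorThru (𝟙 E) f'
  have hr : f' ≫ r = 𝟙 E := Injective.comp_factorThru _ _
  have hE0 : 𝟙 E ≠ 0 := fun h => hE.not_isZero ((IsZero.iff_id_eq_zero E).2 h)
  have : Mono r := by
    by_contra hne
    refine hE.inf_ne_bot (kernelSubobject r) (Subobject.mk f')
      ((kernelSubobject_ne_bot_iff r).2 hne) ?_ ?_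
    · rw [Ne, Subobject.mk_eq_bot_iff_zero]
      intro h
      rw [h, zero_comp] at hr
      exact hE0 hr.symm
    · by_contra hne
      let M := kernelSubobject r ⊓ Subobject.mk f'
      apply (subobject_ne_bot_iff M).1 hne
      let b := Subobject.ofLEMk M f' inf_le_right
      have hb : b ≫ f' = M.arrow := Subobject.ofLEMk_comp _
      have h1 : M.arrow ≫ r = 0 :=
        (kernelSubobject_factors_iff _ _).1 (Subobject.inf_arrow_factors_left _ _)
      rw [← hb, Category.assoc, hr, Category.comp_id] at h1
      rw [← hb, h1, zero_comp]
  exact ⟨r, hr, by rw [← cancel_mono r, Category.assoc, hr, Category.comp_id, Category.id_comp]⟩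

lemma spectralEnd_eq_zero_iff (f : End E) : spectralEnd C E f = 0 ↔ ¬ Mono f.asHom := by
  refine (SpectralHom.of_eq_zero_iff f.asHom).trans ⟨?_, fun h => ?_⟩
  · rintro ⟨A, hA⟩ h
    have hA : A.ι = 0 := (cancel_mono f.asHom).1 (by rw [hA, zero_comp])
    have hA : A.sub = ⊥ := by
      by_contra hne
      exact (subobject_ne_bot_iff _).1 hne hA
    have ht : (⊤ : Subobject E) ≠ ⊥ := by
      rw [subobject_ne_bot_iff]
      intro h
      refine hE.not_isZero ((IsZero.iff_id_eq_zero E).2 ?_)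
      rw [← cancel_epi (⊤ : Subobject E).arrow, h, zero_comp, zero_comp]
    exact A.isEssential ⊤ ht (by rw [hA, inf_bot_eq])
  · exact ⟨⟨_, hE.isEssential ((kernelSubobject_ne_bot_iff _).2 h)⟩, kernelSubobject_arrow_comp _⟩

lemma mem_ker_spectralEnd_iff [Injective E] (f : End E) :
    f ∈ RingHom.ker (spectralEnd C E) ↔ ¬ IsUnit f := by
  rw [RingHom.mem_ker, hE.spectralEnd_eq_zero_iff, hE.isUnit_iff_mono]

lemma nontrivial_end : Nontrivial (End E) :=
  ⟨𝟙 E, 0, fun h => hE.not_isZero ((IsZero.iff_id_eq_zero E).2 h)⟩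

lemma isSkewField [Injective E] : IsSkewField (End ((toSpectral C).obj E)) := by
  have h1 : spectralEnd C E 1 ≠ 0 := fun h => (hE.mem_ker_spectralEnd_iff 1).1 h isUnit_one
  rw [map_one] at h1
  refine ⟨⟨1, 0, h1⟩, fun a ha => ?_⟩
  obtain ⟨f, rfl⟩ := spectralEnd_surjective E a
  by_contra hf
  exact ha ((hE.mem_ker_spectralEnd_iff f).2 fun hu => hf (hu.map _))

lemma isLocalRing [Injective E] : IsLocalRing (End E) := by
  have := hE.nontrivial_end
  refine ⟨fun {a b} hab => ?_⟩
  by_contra! h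
  rw [← hE.mem_ker_spectralEnd_iff, ← hE.mem_ker_spectralEnd_iff] at h
  exact (hE.mem_ker_spectralEnd_iff 1).1 (hab ▸ add_mem h.1 h.2) isUnit_one

/-- A proper left ideal contains no units, so it lies in the kernel. -/
lemma isMaximal_iff [Injective E] (I : Ideal (End E)) :
    I.IsMaximal ↔ I = RingHom.ker (spectralEnd C E) := by
  have hle : ∀ I : Ideal (End E), I ≠ ⊤ → I ≤ RingHom.ker (spectralEnd C E) := fun I hI f hf =>
    (hE.mem_ker_spectralEnd_iff f).2 fun hu => hI (I.eq_top_of_isUnit_mem hf hu)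
  have hne : RingHom.ker (spectralEnd C E) ≠ ⊤ := fun h =>
    (hE.mem_ker_spectralEnd_iff 1).1 (h ▸ Submodule.mem_top) isUnit_one
  constructor
  · exact fun h => h.eq_of_le hne (hle I h.ne_top)
  · rintro rfl
    refine ⟨hne, fun K hK => ?_⟩
    by_contra hK'
    exact hK.not_ge (hle K hK')

lemma isMonoform_iff [Injective E] {N : C} (n : N ⟶ E) [Mono n] (hN : ¬ IsZero N) :
    IsMonoform N ↔ ∀ f : E ⟶ E, ¬ Mono f → n ≫ f = 0 := by
  have hn : n ≠ 0 := fun h => hN (IsZero.of_mono_eq_zero n h)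
  have hn' : Subobject.mk n ≠ ⊥ := by rwa [Ne, Subobject.mk_eq_bot_iff_zero]
  constructor
  · intro h f hf
    by_contra hnf
    let K := kernelSubobject (n ≫ f)
    -- `K` contains the intersection of `N` with the kernel of `f`, nonzero by uniformity.
    have hK : K ≠ ⊥ := by
      have h1 := hE.inf_ne_bot _ _ ((kernelSubobject_ne_bot_iff f).2 hf) hn'
      let M := kernelSubobject f ⊓ Subobject.mk n
      rw [kernelSubobject_ne_bot_iff]
      intro _
      apply (subobject_ne_bot_iff M).1 h1
      let b := Subobject.ofLEMk M n inf_le_right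
      have hb : b ≫ n = M.arrow := Subobject.ofLEMk_comp _
      have h2 : M.arrow ≫ f = 0 :=
        (kernelSubobject_factors_iff _ _).1 (Subobject.inf_arrow_factors_left _ _)
      have h3 : b = 0 := (cancel_mono (n ≫ f)).1 (by
        rw [← Category.assoc, hb, h2, zero_comp])
      rw [← hb, h3, zero_comp]
    let q := cokernel.desc K.arrow (n ≫ f) (kernelSubobject_arrow_comp _)
    have hq : cokernel.π K.arrow ≫ q = n ≫ f := cokernel.π_desc _ _ _
    have hqm : Mono q := by
      refine Preadditive.mono_of_cancel_zero _ fun x hx => ?_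
      -- Pulling back along the epimorphism `cokernel.π` lifts `x` to `N`, where it lands in `K`.
      rw [← cancel_epi (pullback.fst x (cokernel.π K.arrow)), comp_zero, pullback.condition]
      have h1 : K.Factors (pullback.snd x (cokernel.π K.arrow)) := by
        rw [kernelSubobject_factors_iff, ← hq, ← Category.assoc, ← pullback.condition,
          Category.assoc, hx, comp_zero]
      rw [← K.factorThru_arrow _ h1, Category.assoc, cokernel.condition, comp_zero]
    have hq0 : Subobject.mk q ≠ ⊥ := by
      rw [Ne, Subobject.mk_eq_bot_iff_zero]
      intro h0
      rw [h0, comp_zero] at hq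
      exact hnf hq.symm
    -- `N` and `N / K` both embed in `E`, so their intersection there is a forbidden common
    -- subobject.
    have h1 := hE.inf_ne_bot _ _ hn' hq0
    refine h.2 K hK ⟨_, Subobject.ofLEMk (Subobject.mk n ⊓ Subobject.mk q) n inf_le_left,
      Subobject.ofLEMk _ q inf_le_right, fun hz => ?_, inferInstance, inferInstance⟩
    exact (subobject_ne_bot_iff _).1 h1 (hz.eq_of_src _ _)
  · refine fun h => ⟨hN, ?_⟩
    rintro M hM ⟨L, i, j, hL, _, _⟩
    -- Two extensions turn a common subobject `L` of `N` and `N / M` into an endomorphism `f` that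
    -- kills `M` but not `N`: from `L` to `N / M`, then from `N` to `E`.
    let g := Injective.factorThru (i ≫ n) j
    have hg : j ≫ g = i ≫ n := Injective.comp_factorThru _ _
    let f := Injective.factorThru (cokernel.π M.arrow ≫ g) n
    have hf : n ≫ f = cokernel.π M.arrow ≫ g := Injective.comp_factorThru _ _
    have hfm : ¬ Mono f := by
      intro _
      apply (subobject_ne_bot_iff M).1 hM
      rw [← cancel_mono (n ≫ f), hf, zero_comp, ← Category.assoc, cokernel.condition, zero_comp]
    have hg0 : g = 0 := by
      rw [← cancel_epi (cokernel.π M.arrow), ← hf, h f hfm, comp_zero]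
    rw [hg0, comp_zero] at hg
    exact hL (IsZero.of_mono_eq_zero (i ≫ n) hg.symm)

end IsUniform

end Uniform

/-! ### The largest monoform subobject -/

section Largest

variable {C : Type u} [Category.{v} C] [Abelian C] [IsGrothendieckAbelian.{w} C]

/-- The infimum is characterised only against subobjects, so `k` is replaced by its image. -/
lemma sInf_factors_of_forall {X W : C} (c : Set (Subobject X)) (k : W ⟶ X)
    (h : ∀ s ∈ c, s.Factors k) : (sInf c).Factors k := by
  have hle : Subobject.mk (Abelian.image.ι k) ≤ sInf c := by
    refine le_sInf fun s hs => ?_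
    have h1 : k ≫ cokernel.π s.arrow = 0 := by
      rw [← s.factorThru_arrow k (h s hs), Category.assoc, cokernel.condition, comp_zero]
    have h2 : Abelian.image.ι k ≫ cokernel.π s.arrow = 0 := by
      rw [← cancel_epi (Abelian.factorThruImage k), ← Category.assoc, Abelian.image.fac, h1,
        comp_zero]
    exact Subobject.mk_le_of_comm (Abelian.monoLift s.arrow _ h2) (Abelian.monoLift_comp _ _ _)
  exact Subobject.factors_of_le _ hle (mk_factors_iff.2 ⟨_, Abelian.image.fac k⟩)

/-- The intersection of the kernels of all endomorphisms which are not monomorphisms. -/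
noncomputable def kernelOfNonMono (E : C) : Subobject E :=
  sInf {K | ∃ f : E ⟶ E, ¬ Mono f ∧ kernelSubobject f = K}

lemma kernelOfNonMono_factors_iff {E W : C} (k : W ⟶ E) :
    (kernelOfNonMono E).Factors k ↔ ∀ f : E ⟶ E, ¬ Mono f → k ≫ f = 0 := by
  constructor
  · intro h f hf
    rw [← kernelSubobject_factors_iff]
    exact Subobject.factors_of_le _ (sInf_le (Set.mem_ofPred.2 ⟨f, hf, rfl⟩)) h
  · intro h
    refine sInf_factors_of_forall _ k ?_
    rintro _ ⟨f, hf, rfl⟩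
    exact (kernelSubobject_factors_iff _ _).2 (h f hf)

lemma kernelOfNonMono_arrow_comp {E : C} (f : E ⟶ E) (hf : ¬ Mono f) :
    (kernelOfNonMono E).arrow ≫ f = 0 :=
  (kernelOfNonMono_factors_iff _).1 (Subobject.factors_self _) f hf

namespace IsUniform

variable {E : C} (hE : IsUniform E)
include hE

/-- Non-monomorphisms form a two-sided ideal, so `f ≫ g` is not mono when `g` is not, and is killed
as well. -/
lemma kernelOfNonMono_factors (f : E ⟶ E) :
    (kernelOfNonMono E).Factors ((kernelOfNonMono E).arrow ≫ f) := by
  rw [kernelOfNonMono_factors_iff]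
  intro g hg
  rw [Category.assoc]
  refine kernelOfNonMono_arrow_comp _ ?_
  have h : (g : End E) ∈ RingHom.ker (spectralEnd C E) := (hE.spectralEnd_eq_zero_iff g).2 hg
  -- Multiplication in `End` reverses composition: this product is `f ≫ g`.
  exact (hE.spectralEnd_eq_zero_iff (End.of g * End.of f)).1
    (Ideal.mul_mem_right (End.of f) (RingHom.ker (spectralEnd C E)) h)

/-- Restriction of endomorphisms to `kernelOfNonMono E`. -/
noncomputable def restrictEnd : End E →+* End (kernelOfNonMono E : C) where
  toFun f := (kernelOfNonMono E).factorThru _ (hE.kernelOfNonMono_factors f)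
  map_one' := by
    refine (cancel_mono (kernelOfNonMono E).arrow).1 ?_
    simp
  map_mul' f g := by
    refine (cancel_mono (kernelOfNonMono E).arrow).1 ?_
    simp
  map_zero' := by
    refine (cancel_mono (kernelOfNonMono E).arrow).1 ?_
    simp
  map_add' f g := by
    refine (cancel_mono (kernelOfNonMono E).arrow).1 ?_
    refine (Subobject.factorThru_arrow _ _ _).trans ((Preadditive.comp_add _ _ _ _ _ _).trans ?_)
    refine Eq.trans ?_ (Preadditive.add_comp _ _ _ _ _ _).symm
    rw [Subobject.factorThru_arrow, Subobject.factorThru_arrow]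

lemma restrictEnd_arrow (f : End E) :
    (hE.restrictEnd f).asHom ≫ (kernelOfNonMono E).arrow = (kernelOfNonMono E).arrow ≫ f.asHom :=
  Subobject.factorThru_arrow _ _ (hE.kernelOfNonMono_factors f)

/-- A non-mono endomorphism kills the intersection by construction; a mono one cannot kill a nonzero
subobject. -/
lemma ker_restrictEnd (h : kernelOfNonMono E ≠ ⊥) :
    RingHom.ker hE.restrictEnd = RingHom.ker (spectralEnd C E) := by
  ext f
  rw [RingHom.mem_ker, RingHom.mem_ker, hE.spectralEnd_eq_zero_iff]
  have h1 : hE.restrictEnd f = 0 ↔ (kernelOfNonMono E).arrow ≫ f.asHom = 0 := by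
    rw [← hE.restrictEnd_arrow, ← cancel_mono (kernelOfNonMono E).arrow, zero_comp]
  rw [h1]
  refine ⟨fun h0 _ => (subobject_ne_bot_iff _).1 h ?_, kernelOfNonMono_arrow_comp _⟩
  exact (cancel_mono f.asHom).1 (by rw [h0, zero_comp])

variable [Injective E]

lemma restrictEnd_surjective : Function.Surjective hE.restrictEnd := by
  intro g
  let f : E ⟶ E := Injective.factorThru (g.asHom ≫ (kernelOfNonMono E).arrow)
    (kernelOfNonMono E).arrow
  refine ⟨f, (cancel_mono (kernelOfNonMono E).arrow).1 ?_⟩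
  exact (hE.restrictEnd_arrow f).trans (Injective.comp_factorThru _ _)

/-- Both rings are quotients of `End E` by the same ideal. -/
lemma nonempty_end_kernelOfNonMono_ringEquiv (h : kernelOfNonMono E ≠ ⊥) :
    Nonempty (End (kernelOfNonMono E : C) ≃+* End ((toSpectral C).obj E)) :=
  ⟨(RingHom.quotientKerEquivOfSurjective hE.restrictEnd_surjective).symm.trans
    ((Ideal.quotEquivOfEq (hE.ker_restrictEnd h)).trans
      (RingHom.quotientKerEquivOfSurjective (spectralEnd_surjective E)))⟩

lemma kernelOfNonMono_ne_bot {H : C} (hH : IsMonoform H) (i : H ⟶ E) [Mono i] :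
    kernelOfNonMono E ≠ ⊥ := by
  intro h
  have hi := (kernelOfNonMono_factors_iff i).2 ((hE.isMonoform_iff i hH.1).1 hH)
  rw [h, Subobject.bot_factors_iff_zero] at hi
  exact hH.1 (IsZero.of_mono_eq_zero i hi)

lemma isGreatest_kernelOfNonMono (h : kernelOfNonMono E ≠ ⊥) :
    IsGreatest {N : Subobject E | IsMonoform (N : C)} (kernelOfNonMono E) := by
  constructor
  · exact (hE.isMonoform_iff (kernelOfNonMono E).arrow fun hz =>
      (subobject_ne_bot_iff _).1 h (hz.eq_of_src _ _)).2 kernelOfNonMono_arrow_comp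
  · intro N hN
    have hf := (kernelOfNonMono_factors_iff N.arrow).2 ((hE.isMonoform_iff N.arrow hN.1).1 hN)
    exact Subobject.le_of_comm _ (Subobject.factorThru_arrow _ _ hf)

end IsUniform

end Largest

end Atoms

theorem mainTheorem6 {C : Type u} [Category.{v} C] [Abelian C] [IsGrothendieckAbelian.{w} C]
    [Atoms.IsLocallyNoetherian.{w} C] (α : Atoms.AtomSpectrum C) :
    (∃ E : C, α.IsInjectiveHull E) ∧
    ∀ E : C, α.IsInjectiveHull E →
      Atoms.IsSkewField (End ((Atoms.toSpectral C).obj E)) ∧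
      (∃ H : Subobject E,
        IsGreatest {N : Subobject E | Atoms.IsMonoform (N : C)} H ∧
        Nonempty (End (H : C) ≃+* End ((Atoms.toSpectral C).obj E))) ∧
      IsLocalRing (End E) ∧
      (∃ (J : Ideal (End E)) (_ : J.IsTwoSided),
        (∀ f : End E, f ∈ J ↔ ¬ IsUnit f) ∧
        (∀ I : Ideal (End E), I.IsMaximal ↔ I = J) ∧
        Nonempty ((End E ⧸ J) ≃+* End ((Atoms.toSpectral C).obj E))) := by
  refine ⟨α.exists_isInjectiveHull, ?_⟩
  rintro E ⟨⟨H, hH⟩, -, i, hE, _, hi⟩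
  have hU := Atoms.isUniform_of_isEssential hH i hi
  have hne := hU.kernelOfNonMono_ne_bot hH i
  exact ⟨hU.isSkewField,
    ⟨_, hU.isGreatest_kernelOfNonMono hne, hU.nonempty_end_kernelOfNonMono_ringEquiv hne⟩,
    hU.isLocalRing, RingHom.ker (Atoms.spectralEnd C E), inferInstance,
    hU.mem_ker_spectralEnd_iff, hU.isMaximal_iff,
    ⟨RingHom.quotientKerEquivOfSurjective (Atoms.spectralEnd_surjective E)⟩⟩
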